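/- Let $p$ be a polynomial with complex coefficients and $\deg p\ge 2$, and let $P(M)=p(M)$ be the corresponding map on $\mathcal M(2,\mathbb C)$, the space of complex $2\times2$ matrices. Write $f^r$ for the $r$-th iterate of a map $f$, and put $$K_p=\{z\in\mathbb C:\{p^r(z)\}_{r\ge1}\text{ is bounded}\},\qquad J_p=\partial K_p,\qquad K_P=\{M\in\mathcal M(2,\mathbb C):\{P^r(M)\}_{r\ge1}\text{ is bounded}\}.$$ The Fatou set of $P$ is the set of all $M$ having an open neighbourhood $U$ on which $\{P^n\}_{n\ge1}$ is a normal family, that is, every sequence in the family has a subsequence that either converges locally uniformly on $U$ to a holomorphic map or diverges to infinity uniformly on compact subsets of $U$; the Julia set $J_P$ is the complement of the Fatou set. Then $$J_P=\partial\,\overline{K_P}=\left\{Q\begin{pmatrix}\lambda_1&0\\0&\lambda_2\end{pmatrix}Q^{-1}:(\lambda_1,\lambda_2)\in(K_p\times J_p)\cup(J_p\times K_p),\ Q\in \mathrm{GL}(2,\mathbb C)\right\}\cup\left\{Q\begin{pmatrix}\lambda&1\\0&\lambda\end{pmatrix}Q^{-1}:\lambda\in J_p,\ Q\in \mathrm{GL}(2,\mathbb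 C)\right\}.$$ -/

import Mathlib

open Polynomial Matrix Filter Set

-- The entrywise sup norm on matrices; all norms on `M(2, ℂ)` are equivalent, so the notions below
-- (boundedness, topology, locally uniform convergence, holomorphy) do not depend on this choice.
attribute [local instance] Matrix.normedAddCommGroup Matrix.normedSpace

/-- The sequence `u` diverges uniformly to infinity on compact subsets of `U`: for all compact
`K ⊆ U` and every bound `R`, eventually `‖u n x‖ > R` for all `x ∈ K`. -/
def DivergesLocallyUniformlyOn {E F : Type*} [NormedAddCommGroup E] [NormedAddCommGroup F]
    (u : ℕ → E → F) (U : Set E) : Prop :=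
  ∀ K ⊆ U, IsCompact K → ∀ R : ℝ, ∀ᶠ n in atTop, ∀ x ∈ K, R < ‖u n x‖

/-- A family `𝓕` of maps is normal on `U` if each sequence in `𝓕` has a subsequence that either
converges locally uniformly on `U` to a holomorphic map or diverges locally uniformly on `U` to
infinity. -/
def IsNormalFamilyOn {E F : Type*} [NormedAddCommGroup E] [NormedSpace ℂ E]
    [NormedAddCommGroup F] [NormedSpace ℂ F] (𝓕 : Set (E → F)) (U : Set E) : Prop :=
  ∀ u : ℕ → E → F, (∀ n, u n ∈ 𝓕) → ∃ φ : ℕ → ℕ, StrictMono φ ∧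
    ((∃ g : E → F, DifferentiableOn ℂ g U ∧
        TendstoLocallyUniformlyOn (fun n => u (φ n)) g atTop U) ∨
      DivergesLocallyUniformlyOn (fun n => u (φ n)) U)

/-- The Fatou set of a self-map: the points with an open neighbourhood on which the iterates
`f^n`, `n ≥ 1`, form a normal family. -/
def fatouSet {E : Type*} [NormedAddCommGroup E] [NormedSpace ℂ E] (f : E → E) : Set E :=
  {x | ∃ U : Set E, IsOpen U ∧ x ∈ U ∧ IsNormalFamilyOn {h | ∃ n : ℕ, 1 ≤ n ∧ h = f^[n]} U}

/-- The Julia set of a self-map: the complement of the Fatou set. -/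
def juliaSet {E : Type*} [NormedAddCommGroup E] [NormedSpace ℂ E] (f : E → E) : Set E :=
  (fatouSet f)ᶜ

/-- The points `x` whose orbit `{f^r(x)}`, `r ≥ 1`, is bounded. -/
def boundedOrbitSet {E : Type*} [NormedAddCommGroup E] (f : E → E) : Set E :=
  {x | Bornology.IsBounded {y | ∃ r : ℕ, 1 ≤ r ∧ y = f^[r] x}}

/-- The filled Julia set `K_p` of a complex polynomial. -/
def filledJulia (p : ℂ[X]) : Set ℂ :=
  boundedOrbitSet fun z => p.eval z

/-- The Julia set `J_p = ∂ K_p` of a complex polynomial. -/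
def polyJulia (p : ℂ[X]) : Set ℂ :=
  frontier (filledJulia p)

/-- The matrix-valued polynomial `P(M) = a_k M^k + ⋯ + a_1 M + a_0 I` on `M(2, ℂ)`. -/
noncomputable def matrixPoly (p : ℂ[X]) (M : Matrix (Fin 2) (Fin 2) ℂ) :
    Matrix (Fin 2) (Fin 2) ℂ :=
  aeval M p

/-
Everything is governed by the spectrum: the eigenvalues of `P^k(M)` are the `p^k(a)`, `a ∈ σ(M)`.

If some eigenvalue lies outside `K_p`, then so does a nearby eigenvalue of every nearby matrix, and
the orbits diverge uniformly near `M`. If `M` has simple spectrum inside `K_p`, Lagrange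
interpolation of `p^k` at the eigenvalues bounds its orbit; since `K_p` has no isolated points, any
matrix with spectrum in `K_p` is a limit of such ones, its repeated eigenvalues being split one at a
time by rank-one perturbations. Hence the closure of `K_P` is `{M | σ(M) ⊆ K_p}`. If `σ(M)` lies in
the interior of `K_p`, Newton interpolation at the eigenvalues, whose divided differences are
controlled by the maximum principle, bounds all `P^k` uniformly near `M`, and Montel's theorem puts
`M` in the Fatou set. On the frontier, bounded and escaping orbits accumulate, so no subsequence of
the iterates can converge or diverge.
-/

open Metric
open scoped Topology

section BoundedOrbits

variable {E : Type*} [NormedAddCommGroup E] {f : E → E} {x : E}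

theorem mem_boundedOrbitSet_iff : x ∈ boundedOrbitSet f ↔ ∃ C : ℝ, ∀ n : ℕ, ‖f^[n] x‖ ≤ C := by
  simp only [boundedOrbitSet, mem_ofPred_eq, isBounded_iff_forall_norm_le]
  constructor
  · rintro ⟨C, hC⟩
    refine ⟨max C ‖x‖, fun n => ?_⟩
    rcases Nat.eq_zero_or_pos n with rfl | hn
    · exact le_max_right _ _
    · exact (hC _ ⟨n, hn, rfl⟩).trans (le_max_left _ _)
  · rintro ⟨C, hC⟩
    refine ⟨C, ?_⟩
    rintro y ⟨n, -, rfl⟩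
    exact hC n

theorem map_mem_boundedOrbitSet_iff : f x ∈ boundedOrbitSet f ↔ x ∈ boundedOrbitSet f := by
  simp only [mem_boundedOrbitSet_iff, ← Function.iterate_succ_apply]
  refine ⟨fun ⟨C, hC⟩ => ⟨max C ‖x‖, fun n => ?_⟩, fun ⟨C, hC⟩ => ⟨C, fun n => hC _⟩⟩
  cases n with
  | zero => exact le_max_right _ _
  | succ n => exact (hC n).trans (le_max_left _ _)

theorem iterate_mem_boundedOrbitSet_iff (n : ℕ) :
    f^[n] x ∈ boundedOrbitSet f ↔ x ∈ boundedOrbitSet f := by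
  induction n with
  | zero => rfl
  | succ n ih => rw [Function.iterate_succ_apply', map_mem_boundedOrbitSet_iff, ih]

theorem mem_interior_boundedOrbitSet_of_attracting {𝕜 : Type*} [NontriviallyNormedField 𝕜]
    [NormedSpace 𝕜 E] {f' : E →L[𝕜] E} (hx : f x = x) (hf : HasFDerivAt f f' x)
    (hf' : ‖f'‖ < 1) : x ∈ interior (boundedOrbitSet f) := by
  have hcontract : ∀ᶠ y in 𝓝 x, ‖f y - x‖ ≤ ‖y - x‖ := by
    filter_upwards [hf.isLittleO.def (sub_pos.2 hf')] with y hy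
    rw [hx] at hy
    calc ‖f y - x‖ = ‖(f y - x - f' (y - x)) + f' (y - x)‖ := by rw [sub_add_cancel]
      _ ≤ (1 - ‖f'‖) * ‖y - x‖ + ‖f'‖ * ‖y - x‖ := norm_add_le_of_le hy (f'.le_opNorm _)
      _ = ‖y - x‖ := by ring
  obtain ⟨ε, hε, hball⟩ := eventually_nhds_iff_ball.1 hcontract
  have hmaps : MapsTo f (ball x ε) (ball x ε) := fun y hy =>
    mem_ball_iff_norm.2 ((hball y hy).trans_lt (mem_ball_iff_norm.1 hy))
  refine mem_interior.2 ⟨ball x ε, fun y hy => ?_, isOpen_ball, mem_ball_self hε⟩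
  refine mem_boundedOrbitSet_iff.2 ⟨ε + ‖x‖, fun n => ?_⟩
  have hn := mem_ball_iff_norm.1 (hmaps.iterate n hy)
  linarith [norm_sub_norm_le (f^[n] y) x]

end BoundedOrbits

section Divergence

variable {E F : Type*} [NormedAddCommGroup E] [NormedAddCommGroup F]

theorem divergesLocallyUniformlyOn_of_forall_exists_mem_nhdsWithin {u : ℕ → E → F} {U : Set E}
    (h : ∀ x ∈ U, ∀ C : ℝ, ∃ t ∈ 𝓝[U] x, ∀ᶠ n in atTop, ∀ y ∈ t, C < ‖u n y‖) :
    DivergesLocallyUniformlyOn u U := by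
  intro s hsU hs C
  refine hs.induction_on (p := fun t => ∀ᶠ n in atTop, ∀ y ∈ t, C < ‖u n y‖)
    (Eventually.of_forall fun _ _ hy => hy.elim)
    (fun s t hst ht => ht.mono fun n hn y hy => hn y (hst hy))
    (fun s t hs ht => ?_) fun x hx => ?_
  · filter_upwards [hs, ht] with n hsn htn y hy
    exact hy.elim (hsn y) (htn y)
  · obtain ⟨t, ht, hn⟩ := h x (hsU hx) C
    exact ⟨t, nhdsWithin_mono x hsU ht, hn⟩

end Divergence

/-- An escape radius of a self-map: outside the closed ball of radius `R`, the map at least doubles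
the norm, so that the orbits leaving this ball tend to infinity. -/
def IsEscapeRadius {E : Type*} [NormedAddCommGroup E] (f : E → E) (R : ℝ) : Prop :=
  0 < R ∧ ∀ x, R < ‖x‖ → 2 * ‖x‖ ≤ ‖f x‖

namespace IsEscapeRadius

variable {E : Type*} [NormedAddCommGroup E] {f : E → E} {R : ℝ}

theorem two_pow_mul_norm_le (hR : IsEscapeRadius f R) {x : E} (hx : R < ‖x‖) (n : ℕ) :
    2 ^ n * ‖x‖ ≤ ‖f^[n] x‖ := by
  induction n generalizing x with
  | zero => simp
  | succ n ih =>
    have hfx := hR.2 x hx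
    calc 2 ^ (n + 1) * ‖x‖ = 2 ^ n * (2 * ‖x‖) := by ring
      _ ≤ 2 ^ n * ‖f x‖ := by gcongr
      _ ≤ ‖f^[n] (f x)‖ := ih (by linarith [norm_nonneg x])
      _ = ‖f^[n + 1] x‖ := by rw [Function.iterate_succ_apply]

theorem eventually_forall_lt_norm_iterate (hR : IsEscapeRadius f R) (m : ℕ) (C : ℝ) :
    ∀ᶠ n in atTop, ∀ x, R < ‖f^[m] x‖ → C < ‖f^[n] x‖ := by
  have hlim : Tendsto (fun n : ℕ => (2 : ℝ) ^ n * R) atTop atTop :=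
    (tendsto_pow_atTop_atTop_of_one_lt one_lt_two).atTop_mul_const hR.1
  filter_upwards [eventually_ge_atTop m,
    (tendsto_sub_atTop_nat m).eventually (hlim.eventually_gt_atTop C)] with n hmn hn x hx
  calc C < 2 ^ (n - m) * R := hn
    _ ≤ 2 ^ (n - m) * ‖f^[m] x‖ := by gcongr
    _ ≤ ‖f^[n - m] (f^[m] x)‖ := hR.two_pow_mul_norm_le hx _
    _ = ‖f^[n] x‖ := by rw [← Function.iterate_add_apply, Nat.sub_add_cancel hmn]

theorem boundedOrbitSet_eq (hR : IsEscapeRadius f R) :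
    boundedOrbitSet f = {x | ∀ n, ‖f^[n] x‖ ≤ R} := by
  ext x
  refine mem_boundedOrbitSet_iff.trans ⟨fun ⟨C, hC⟩ m => ?_, fun h => ⟨R, h⟩⟩
  by_contra! hm
  obtain ⟨n, hn⟩ := (hR.eventually_forall_lt_norm_iterate m C).exists
  exact (hC n).not_gt (hn x hm)

theorem norm_iterate_le (hR : IsEscapeRadius f R) {x : E} (hx : x ∈ boundedOrbitSet f) (n : ℕ) :
    ‖f^[n] x‖ ≤ R := by
  rw [hR.boundedOrbitSet_eq] at hx
  exact hx n

theorem isClosed_boundedOrbitSet (hR : IsEscapeRadius f R) (hf : Continuous f) :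
    IsClosed (boundedOrbitSet f) := by
  rw [hR.boundedOrbitSet_eq, ofPred_forall]
  exact isClosed_iInter fun n => isClosed_le (hf.iterate n).norm continuous_const

theorem divergesLocallyUniformlyOn_compl (hR : IsEscapeRadius f R) (hf : Continuous f) :
    DivergesLocallyUniformlyOn (fun n => f^[n]) (boundedOrbitSet f)ᶜ := by
  refine divergesLocallyUniformlyOn_of_forall_exists_mem_nhdsWithin fun x hx C => ?_
  rw [hR.boundedOrbitSet_eq, mem_compl_iff, mem_ofPred_eq, not_forall] at hx
  obtain ⟨m, hm⟩ := hx
  exact ⟨{y | R < ‖f^[m] y‖}, mem_nhdsWithin_of_mem_nhds <|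
    (isOpen_lt continuous_const (hf.iterate m).norm).mem_nhds (not_le.1 hm),
    hR.eventually_forall_lt_norm_iterate m C⟩

end IsEscapeRadius

section FilledJulia

variable {p : ℂ[X]}

theorem exists_isEscapeRadius (hp : 2 ≤ p.natDegree) :
    ∃ R, IsEscapeRadius (fun z => p.eval z) R := by
  have hdeg : 0 < p.divX.degree := by
    rw [← natDegree_pos_iff_degree_pos, natDegree_divX_eq_natDegree_tsub_one]
    omega
  have hlarge := (p.divX.tendsto_norm_atTop hdeg
    (tendsto_norm_cobounded_atTop (E := ℂ))).eventually_ge_atTop 3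
  rw [← comap_norm_atTop, eventually_comap] at hlarge
  obtain ⟨R, hR⟩ := eventually_atTop.1 hlarge
  refine ⟨max (max R 1) ‖p.coeff 0‖, by positivity, fun z hz => ?_⟩
  simp only [max_lt_iff] at hz
  have heval : p.eval z = p.divX.eval z * z + p.coeff 0 := by
    conv_lhs => rw [← divX_mul_X_add p]
    simp only [eval_add, eval_mul, eval_X, eval_C]
  calc 2 * ‖z‖ ≤ 3 * ‖z‖ - ‖p.coeff 0‖ := by linarith
    _ ≤ ‖p.divX.eval z‖ * ‖z‖ - ‖p.coeff 0‖ := by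
        gcongr
        exact hR _ hz.1.1.le z rfl
    _ = ‖p.divX.eval z * z‖ - ‖-p.coeff 0‖ := by rw [norm_mul, norm_neg]
    _ ≤ ‖p.divX.eval z * z - -p.coeff 0‖ := norm_sub_norm_le _ _
    _ = ‖p.eval z‖ := by rw [heval, sub_neg_eq_add]

theorem isClosed_filledJulia (hp : 2 ≤ p.natDegree) : IsClosed (filledJulia p) :=
  let ⟨_, hR⟩ := exists_isEscapeRadius hp
  hR.isClosed_boundedOrbitSet p.continuous

theorem polyJulia_subset_filledJulia (hp : 2 ≤ p.natDegree) : polyJulia p ⊆ filledJulia p :=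
  (isClosed_filledJulia hp).frontier_subset

theorem filledJulia_ne_singleton (hp : 2 ≤ p.natDegree) (a : ℂ) : filledJulia p ≠ {a} := by
  intro hK
  have hmap : ∀ z, p.eval z = a ↔ z = a := fun z => by
    have hz : p.eval z ∈ filledJulia p ↔ z ∈ filledJulia p :=
      map_mem_boundedOrbitSet_iff (f := fun z => p.eval z)
    simpa only [hK, mem_singleton_iff] using hz
  have hdeg : (p - C a).natDegree = p.natDegree := natDegree_sub_C
  have hne : p - C a ≠ 0 := ne_zero_of_natDegree_gt (n := 1) (by omega)
  have hroots : (p - C a).roots = Multiset.replicate p.natDegree a := by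
    refine Multiset.eq_replicate.2 ⟨?_, fun z hz => ?_⟩
    · rw [← hdeg, splits_iff_card_roots.1 (IsAlgClosed.splits _)]
    · simpa only [mem_roots hne, IsRoot, eval_sub, eval_C, sub_eq_zero, hmap] using hz
  have hderiv : (derivative p).eval a = 0 := by
    have hmult : 1 < (p - C a).rootMultiplicity a := by
      rw [← count_roots, hroots, Multiset.count_replicate_self]
      omega
    simpa using ((one_lt_rootMultiplicity_iff_isRoot hne).1 hmult).2
  have hfderiv : HasFDerivAt (fun z => p.eval z) (0 : ℂ →L[ℂ] ℂ) a := by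
    simpa [hderiv] using (p.hasDerivAt a).hasFDerivAt
  have hint : a ∈ interior (filledJulia p) :=
    mem_interior_boundedOrbitSet_of_attracting ((hmap a).2 rfl) hfderiv (by simp)
  rw [hK, interior_singleton] at hint
  exact hint

-- Around an isolated point `a` of the filled Julia set `K`, a high iterate is large on a small
-- circle, hence maps the disc onto a neighbourhood of `K`. As `a` is the only point of the
-- disc mapped into `K`, this forces `K` to be a single point.
theorem preperfect_filledJulia (hp : 2 ≤ p.natDegree) : Preperfect (filledJulia p) := by
  intro a ha
  by_contra hacc
  rw [accPt_iff_frequently_nhdsNE, not_frequently] at hacc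
  obtain ⟨R, hR⟩ := exists_isEscapeRadius hp
  obtain ⟨r, hr, hball⟩ := nhds_basis_closedBall.eventually_iff.1
    (eventually_nhdsWithin_iff.1 hacc)
  have hiso : ∀ z ∈ closedBall a r, z ∈ filledJulia p → z = a := fun z hz hzK =>
    not_not.1 fun hza => hball hz hza hzK
  have hsphere : sphere a r ⊆ (filledJulia p)ᶜ := fun z hz hzK =>
    ne_of_mem_sphere hz hr.ne' (hiso z (sphere_subset_closedBall hz) hzK)
  obtain ⟨n, hn⟩ := (hR.divergesLocallyUniformlyOn_compl p.continuous (sphere a r) hsphere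
    (isCompact_sphere a r) (6 * R)).exists
  set f := (fun z => p.eval z)^[n]
  have hf : ∀ z, f z ∈ filledJulia p ↔ z ∈ filledJulia p := fun _ =>
    iterate_mem_boundedOrbitSet_iff n
  have hfa : ‖f a‖ ≤ R := hR.norm_iterate_le ha n
  have hlarge : ∀ z ∈ sphere a r, 5 * R ≤ ‖f z - f a‖ := fun z hz => by
    linarith [norm_sub_norm_le (f z) (f a), hn z hz]
  have hnonconst : ∃ᶠ z in 𝓝 a, f z ≠ f a := by
    refine (hacc.mono fun z hz (hfz : f z = f a) => hz ?_).frequently.filter_mono nhdsWithin_le_nhds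
    rwa [← hf, hfz, hf]
  have himage := (p.differentiable.iterate n).diffContOnCl.ball_subset_image_closedBall hr hlarge
    hnonconst
  refine filledJulia_ne_singleton hp (f a) (subset_antisymm (fun w hw => ?_)
    (singleton_subset_iff.2 ((hf a).2 ha)))
  have hwR : ‖w‖ ≤ R := hR.norm_iterate_le hw 0
  obtain ⟨z, hz, rfl⟩ := himage (mem_ball_iff_norm.2
    (by linarith [norm_sub_le w (f a), hR.1] : ‖w - f a‖ < 5 * R / 2))
  rw [hiso z hz ((hf z).1 hw), mem_singleton_iff]

end FilledJulia

section Montel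

variable {E F : Type*} [NormedAddCommGroup E] [NormedSpace ℂ E] [NormedAddCommGroup F]
  [NormedSpace ℂ F]

theorem norm_fderiv_le_of_forall_mem_ball {f : E → F} {x : E} {r C : ℝ} (hr : 0 < r)
    (hf : DifferentiableOn ℂ f (ball x r)) (hC : ∀ y ∈ ball x r, ‖f y‖ ≤ C) :
    ‖fderiv ℂ f x‖ ≤ 2 * C / r := by
  refine Complex.norm_fderiv_le_div_of_mapsTo_ball hf (fun y hy => ?_) hr
  rw [mem_closedBall_iff_norm, two_mul]
  exact norm_sub_le_of_le (hC y hy) (hC x (mem_ball_self hr))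

theorem uniformCauchySeqOn_fderiv {ι : Type*} {l : Filter ι} {u : ι → E → F} {s t : Set E}
    {r : ℝ} (hr : 0 < r) (hu : ∀ n, DifferentiableOn ℂ (u n) s) (h : UniformCauchySeqOn u l s)
    (hts : ∀ y ∈ t, ball y r ⊆ s) : UniformCauchySeqOn (fun n => fderiv ℂ (u n)) l t := by
  intro v hv
  obtain ⟨ε, hε, hεv⟩ := Metric.mem_uniformity_dist.1 hv
  filter_upwards [h _ (Metric.dist_mem_uniformity (by positivity : 0 < ε * r / 4))] with n hn y hy
  have hdiff : ∀ m, DifferentiableAt ℂ (u m) y := fun m =>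
    (hu m).differentiableAt (mem_of_superset (ball_mem_nhds y hr) (hts y hy))
  refine hεv ?_
  rw [dist_eq_norm, ← fderiv_sub (hdiff n.1) (hdiff n.2)]
  calc ‖fderiv ℂ (u n.1 - u n.2) y‖ ≤ 2 * (ε * r / 4) / r :=
        norm_fderiv_le_of_forall_mem_ball hr (((hu n.1).sub (hu n.2)).mono (hts y hy))
          fun z hz => by simpa only [Pi.sub_apply, dist_eq_norm] using (hn z (hts y hy hz)).le
    _ = ε / 2 := by field_simp; ring
    _ < ε := half_lt_self hε

theorem differentiableOn_of_tendstoUniformlyOn [CompleteSpace F] {ι : Type*} {l : Filter ι}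
    [l.NeBot] {u : ι → E → F} {g : E → F} {s : Set E} (hs : IsOpen s)
    (hu : ∀ n, DifferentiableOn ℂ (u n) s) (h : TendstoUniformlyOn u g l s) :
    DifferentiableOn ℂ g s := by
  intro x hx
  obtain ⟨ε, hε, hεs⟩ := Metric.isOpen_iff.1 hs x hx
  have hballs : ∀ y ∈ ball x (ε / 2), ball y (ε / 2) ⊆ s := fun y hy =>
    (ball_subset_ball' (by linarith [mem_ball.1 hy])).trans hεs
  have hsub : ball x (ε / 2) ⊆ s := (ball_subset_ball (half_le_self hε.le)).trans hεs
  have hcauchy := uniformCauchySeqOn_fderiv (half_pos hε) hu h.uniformCauchySeqOn hballs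
  let g' : E → E →L[ℂ] F := fun y => lim (map (fun n => fderiv ℂ (u n) y) l)
  have hderiv : HasFDerivAt g (g' x) x :=
    hasFDerivAt_of_tendstoUniformlyOn (g' := g') isOpen_ball
      (hcauchy.tendstoUniformlyOn_of_tendsto fun y hy => (hcauchy.cauchy_map hy).le_nhds_lim)
      (fun n y hy => ((hu n).differentiableAt (hs.mem_nhds (hsub hy))).hasFDerivAt)
      (fun y hy => h.tendsto_at (hsub hy)) (mem_ball_self (half_pos hε))
  exact hderiv.differentiableAt.differentiableWithinAt

theorem lipschitzOnWith_closedBall_of_forall_norm_le {f : E → F} {x : E} {r C : ℝ}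
    (hr : 0 < r) (hf : DifferentiableOn ℂ f (ball x (2 * r)))
    (hC : ∀ y ∈ ball x (2 * r), ‖f y‖ ≤ C) :
    LipschitzOnWith (2 * C / r).toNNReal f (closedBall x r) := by
  have hballs : ∀ y ∈ closedBall x r, ball y r ⊆ ball x (2 * r) := fun y hy =>
    ball_subset_ball' (by linarith [mem_closedBall.1 hy])
  refine (convex_closedBall x r).lipschitzOnWith_of_nnnorm_fderiv_le (𝕜 := ℂ)
    (fun y hy => hf.differentiableAt ?_) fun y hy => ?_
  · exact mem_of_superset (ball_mem_nhds y hr) (hballs y hy)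
  · exact NNReal.le_toNNReal_of_coe_le (norm_fderiv_le_of_forall_mem_ball hr
      (hf.mono (hballs y hy)) fun z hz => hC z (hballs y hy hz))

theorem exists_subseq_tendstoUniformlyOn_of_lipschitzOnWith {X F : Type*} [PseudoMetricSpace X]
    [NormedAddCommGroup F] [ProperSpace F] {u : ℕ → X → F} {s : Set X} {C : ℝ} {L : NNReal}
    (hs : IsCompact s) (hu : ∀ n, LipschitzOnWith L (u n) s) (hC : ∀ n, ∀ x ∈ s, ‖u n x‖ ≤ C) :
    ∃ φ : ℕ → ℕ, StrictMono φ ∧ ∃ g : X → F, TendstoUniformlyOn (fun n => u (φ n)) g atTop s := by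
  have : CompactSpace s := isCompact_iff_compactSpace.1 hs
  let v : ℕ → BoundedContinuousFunction s F := fun n =>
    BoundedContinuousFunction.mkOfCompact ⟨fun x => u n x, (hu n).continuousOn.domRestrict⟩
  have hcompact : IsCompact (closure (range v)) := by
    refine BoundedContinuousFunction.arzela_ascoli (closedBall 0 C) (isCompact_closedBall 0 C) _
      ?_ ?_
    · rintro _ x ⟨n, rfl⟩
      exact mem_closedBall_zero_iff.2 (hC n x x.2)
    · refine (LipschitzWith.uniformEquicontinuous _ L ?_).equicontinuous
      rintro ⟨_, n, rfl⟩
      exact (hu n).to_restrict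
  obtain ⟨G, -, φ, hφ, hG⟩ := hcompact.tendsto_subseq fun n => subset_closure (mem_range_self n)
  refine ⟨φ, hφ, Function.extend Subtype.val G 0, ?_⟩
  rw [tendstoUniformlyOn_iff_tendstoUniformly_comp_coe,
    Function.extend_comp Subtype.val_injective]
  exact BoundedContinuousFunction.tendsto_iff_tendstoUniformly.1 hG

theorem exists_subseq_tendstoUniformlyOn_ball [ProperSpace E] [ProperSpace F]
    {u : ℕ → E → F} {x : E} {r C : ℝ} (hr : 0 < r)
    (hu : ∀ n, DifferentiableOn ℂ (u n) (ball x (2 * r)))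
    (hC : ∀ n, ∀ y ∈ ball x (2 * r), ‖u n y‖ ≤ C) :
    ∃ φ : ℕ → ℕ, StrictMono φ ∧ ∃ g : E → F, DifferentiableOn ℂ g (ball x r) ∧
      TendstoUniformlyOn (fun n => u (φ n)) g atTop (ball x r) := by
  have hsub : closedBall x r ⊆ ball x (2 * r) := closedBall_subset_ball (by linarith)
  obtain ⟨φ, hφ, g, hg⟩ := exists_subseq_tendstoUniformlyOn_of_lipschitzOnWith
    (isCompact_closedBall x r)
    (fun n => lipschitzOnWith_closedBall_of_forall_norm_le hr (hu n) (hC n))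
    fun n y hy => hC n y (hsub hy)
  have hball := hg.mono ball_subset_closedBall
  exact ⟨φ, hφ, g, differentiableOn_of_tendstoUniformlyOn isOpen_ball
    (fun n => (hu (φ n)).mono (ball_subset_closedBall.trans hsub)) hball, hball⟩

end Montel

section Fatou

theorem exists_subseq_eq_or_tendsto_atTop (k : ℕ → ℕ) :
    ∃ φ : ℕ → ℕ, StrictMono φ ∧ ((∃ c, ∀ n, k (φ n) = c) ∨ Tendsto (k ∘ φ) atTop atTop) := by
  by_cases h : ∃ c, ∃ᶠ n in atTop, k n = c
  · obtain ⟨c, hc⟩ := h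
    obtain ⟨φ, hφ, hφc⟩ := extraction_of_frequently_atTop hc
    exact ⟨φ, hφ, Or.inl ⟨c, hφc⟩⟩
  · refine ⟨id, strictMono_id, Or.inr (tendsto_atTop.2 fun b => ?_)⟩
    simp only [not_exists, not_frequently] at h
    filter_upwards [(Finset.eventually_all (Finset.range b)).2 fun c _ => h c] with n hn
    by_contra! hlt
    exact hn (k n) (Finset.mem_range.2 hlt) rfl

variable {E : Type*} [NormedAddCommGroup E] [NormedSpace ℂ E] {f : E → E}

theorem subset_fatouSet_of_divergesLocallyUniformlyOn (hf : Differentiable ℂ f) {U : Set E}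
    (hU : IsOpen U) (h : DivergesLocallyUniformlyOn (fun n => f^[n]) U) : U ⊆ fatouSet f := by
  refine fun x hx => ⟨U, hU, hx, fun u hu => ?_⟩
  choose k _ hk using hu
  obtain ⟨φ, hφ, ⟨c, hc⟩ | hlim⟩ := exists_subseq_eq_or_tendsto_atTop k
  · refine ⟨φ, hφ, Or.inl ⟨f^[c], (hf.iterate c).differentiableOn, ?_⟩⟩
    simp only [hk, hc]
    exact fun v hv y _ => ⟨U, self_mem_nhdsWithin, by simp [refl_mem_uniformity hv]⟩
  · refine ⟨φ, hφ, Or.inr fun s hsU hs C => ?_⟩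
    simpa only [hk, Function.comp_apply] using hlim.eventually (h s hsU hs C)

theorem mem_fatouSet_of_eventually_norm_iterate_le [ProperSpace E] (hf : Differentiable ℂ f)
    {x : E} {C : ℝ} (h : ∀ᶠ y in 𝓝 x, ∀ n, ‖f^[n] y‖ ≤ C) : x ∈ fatouSet f := by
  obtain ⟨ε, hε, hball⟩ := eventually_nhds_iff_ball.1 h
  rw [← mul_div_cancel₀ ε two_ne_zero] at hball
  refine ⟨ball x (ε / 2), isOpen_ball, mem_ball_self (half_pos hε), fun u hu => ?_⟩
  choose k _ hk using hu
  obtain rfl : u = fun n => f^[k n] := funext hk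
  obtain ⟨φ, hφ, g, hg, hlim⟩ := exists_subseq_tendstoUniformlyOn_ball (half_pos hε)
    (fun n => (hf.iterate (k n)).differentiableOn) fun n y hy => hball y hy (k n)
  exact ⟨φ, hφ, Or.inl ⟨g, hg, hlim.tendstoLocallyUniformlyOn⟩⟩

theorem IsNormalFamilyOn.not_tendsto_norm_iterate_atTop {U : Set E} {x y : E}
    (h : IsNormalFamilyOn {g | ∃ n : ℕ, 1 ≤ n ∧ g = f^[n]} U) (hx : x ∈ U) (hy : y ∈ U)
    (hbdd : x ∈ boundedOrbitSet f) : ¬ Tendsto (fun n => ‖f^[n] y‖) atTop atTop := by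
  intro hesc
  obtain ⟨φ, hφ, ⟨g, -, hg⟩ | hdiv⟩ := h (fun n => f^[n + 1]) fun n => ⟨n + 1, by omega, rfl⟩
  · exact not_tendsto_atTop_of_tendsto_nhds (hg.tendsto_at hy).norm
      (hesc.comp ((tendsto_add_atTop_nat 1).comp hφ.tendsto_atTop))
  · obtain ⟨C, hC⟩ := mem_boundedOrbitSet_iff.1 hbdd
    obtain ⟨n, hn⟩ := (hdiv {x} (singleton_subset_iff.2 hx) isCompact_singleton C).exists
    exact (hC (φ n + 1)).not_gt (hn x rfl)

theorem juliaSet_eq_frontier_closure_boundedOrbitSet [ProperSpace E] (hf : Differentiable ℂ f)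
    (hesc : DivergesLocallyUniformlyOn (fun n => f^[n]) (closure (boundedOrbitSet f))ᶜ)
    (hbdd : ∀ x ∈ interior (closure (boundedOrbitSet f)),
      ∃ C, ∀ᶠ y in 𝓝 x, ∀ n, ‖f^[n] y‖ ≤ C) :
    juliaSet f = frontier (closure (boundedOrbitSet f)) := by
  refine subset_antisymm (fun x hx => ?_) fun x hx => ?_
  · rw [isClosed_closure.frontier_eq]
    refine ⟨not_not.1 fun h => hx ?_, fun h => hx ?_⟩
    · exact subset_fatouSet_of_divergesLocallyUniformlyOn hf isClosed_closure.isOpen_compl hesc h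
    · obtain ⟨C, hC⟩ := hbdd x h
      exact mem_fatouSet_of_eventually_norm_iterate_le hf hC
  · rintro ⟨U, hU, hxU, hnormal⟩
    rw [frontier_eq_closure_inter_closure, closure_closure] at hx
    obtain ⟨y, hyU, hy⟩ := mem_closure_iff.1 hx.1 U hU hxU
    obtain ⟨z, hzU, hz⟩ := mem_closure_iff.1 hx.2 U hU hxU
    refine hnormal.not_tendsto_norm_iterate_atTop hyU hzU hy (tendsto_atTop.2 fun C => ?_)
    filter_upwards [hesc {z} (singleton_subset_iff.2 hz) isCompact_singleton C] with n hn
    exact (hn z rfl).le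

end Fatou

section EntrywiseNorm

variable {n : Type*} [Fintype n]

theorem norm_matrix_mul_le {l m R : Type*} [Fintype l] [Fintype m] [NonUnitalNormedRing R]
    (A : Matrix l n R) (B : Matrix n m R) : ‖A * B‖ ≤ Fintype.card n * ‖A‖ * ‖B‖ := by
  refine (norm_le_iff (by positivity)).2 fun i j => ?_
  calc ‖(A * B) i j‖ ≤ ∑ _k : n, ‖A‖ * ‖B‖ := by
        rw [mul_apply]
        refine norm_sum_le_of_le _ fun k _ => (norm_mul_le _ _).trans ?_
        gcongr <;> exact norm_entry_le_entrywise_sup_norm _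
    _ = Fintype.card n * ‖A‖ * ‖B‖ := by
        rw [Finset.sum_const, Finset.card_univ, nsmul_eq_mul, mul_assoc]

theorem differentiable_matrix_mul {𝕜 E : Type*} [NontriviallyNormedField 𝕜]
    [NormedAddCommGroup E] [NormedSpace 𝕜 E] {f g : E → Matrix n n 𝕜}
    (hf : Differentiable 𝕜 f) (hg : Differentiable 𝕜 g) :
    Differentiable 𝕜 fun x => f x * g x := by
  refine differentiable_pi.2 fun i => differentiable_pi.2 fun j => ?_
  simp only [mul_apply]
  exact Differentiable.fun_sum fun k _ =>
    (differentiable_pi.1 (differentiable_pi.1 hf i) k).mul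
      (differentiable_pi.1 (differentiable_pi.1 hg k) j)

variable [DecidableEq n]

theorem norm_one_matrix_le_one : ‖(1 : Matrix n n ℂ)‖ ≤ 1 := by
  refine (norm_le_iff zero_le_one).2 fun i j => ?_
  rw [one_apply]
  split_ifs <;> simp

theorem norm_le_card_mul_norm_of_mem_spectrum {M : Matrix n n ℂ} {a : ℂ}
    (ha : a ∈ spectrum ℂ M) : ‖a‖ ≤ Fintype.card n * ‖M‖ := by
  rw [← spectrum_toLin', ← Module.End.hasEigenvalue_iff_mem_spectrum] at ha
  obtain ⟨k, hk⟩ := eigenvalue_mem_ball ha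
  calc ‖a‖ ≤ ‖a - M k k‖ + ‖M k k‖ := by simpa using norm_add_le (a - M k k) (M k k)
    _ ≤ (∑ j ∈ Finset.univ.erase k, ‖M k j‖) + ‖M k k‖ := by
        gcongr
        exact mem_closedBall_iff_norm.1 hk
    _ = ∑ j, ‖M k j‖ := Finset.sum_erase_add _ _ (Finset.mem_univ k)
    _ ≤ ∑ _j : n, ‖M‖ := Finset.sum_le_sum fun j _ => norm_entry_le_entrywise_sup_norm M
    _ = Fintype.card n * ‖M‖ := by rw [Finset.sum_const, Finset.card_univ, nsmul_eq_mul]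

end EntrywiseNorm

section SpectrumTopology

variable {n : Type*} [Fintype n] [DecidableEq n] {M : Matrix n n ℂ} {S : Set ℂ} {a : ℂ}

theorem mem_spectrum_iff_det_eq_zero {K : Type*} [Field K] {M : Matrix n n K} {a : K} :
    a ∈ spectrum K M ↔ (scalar n a - M).det = 0 := by
  rw [mem_spectrum_iff_isRoot_charpoly, IsRoot, eval_charpoly]

theorem card_roots_charpoly : M.charpoly.roots.card = Fintype.card n := by
  rw [← (IsAlgClosed.splits _).natDegree_eq_card_roots, charpoly_natDegree_eq_dim]

theorem mem_roots_charpoly_iff : a ∈ M.charpoly.roots ↔ a ∈ spectrum ℂ M := by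
  rw [mem_roots M.charpoly_monic.ne_zero, mem_spectrum_iff_isRoot_charpoly]

theorem exists_mem_spectrum_norm_sub_lt {ε : ℝ} (hε : 0 ≤ ε)
    (h : ‖(scalar n a - M).det‖ < ε ^ Fintype.card n) : ∃ b ∈ spectrum ℂ M, ‖a - b‖ < ε := by
  by_contra! hfar
  refine h.not_ge ?_
  calc ε ^ Fintype.card n = (M.charpoly.roots.map fun _ => ε).prod := by
        rw [Multiset.map_const', Multiset.prod_replicate, card_roots_charpoly]
    _ ≤ (M.charpoly.roots.map fun b => ‖a - b‖).prod :=
        Multiset.prod_map_le_prod_map₀ _ _ (fun _ _ => hε)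
          fun b hb => hfar b (mem_roots_charpoly_iff.1 hb)
    _ = ‖(M.charpoly.roots.map fun b => a - b).prod‖ := by
        refine .symm ((map_multiset_prod (normHom : ℂ →*₀ ℝ) _).trans ?_)
        rw [Multiset.map_map]
        rfl
    _ = ‖(scalar n a - M).det‖ := by
        rw [← eval_charpoly,
          (IsAlgClosed.splits _).eval_eq_prod_roots_of_monic M.charpoly_monic]

theorem isOpen_setOf_spectrum_subset (hS : IsOpen S) :
    IsOpen {M : Matrix n n ℂ | spectrum ℂ M ⊆ S} := by
  refine isOpen_iff_mem_nhds.2 fun M hM => ?_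
  have hbound : ∀ᶠ N in 𝓝 M, ‖N‖ < ‖M‖ + 1 :=
    continuous_norm.continuousAt.eventually_lt_const (lt_add_one _)
  have hcompact : IsCompact (closedBall (0 : ℂ) (Fintype.card n * (‖M‖ + 1)) \ S) :=
    (isCompact_closedBall _ _).diff hS
  have hdet : ∀ᶠ N in 𝓝 M, ∀ z ∈ closedBall (0 : ℂ) (Fintype.card n * (‖M‖ + 1)) \ S,
      (scalar n z - N).det ≠ 0 := by
    refine hcompact.eventually_forall_of_forall_eventually fun z hz => ?_
    have hcont : Continuous fun q : Matrix n n ℂ × ℂ => (scalar n q.2 - q.1).det := by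
      simp only [scalar_apply]
      fun_prop
    exact hcont.continuousAt.eventually_ne fun h0 => hz.2 (hM (mem_spectrum_iff_det_eq_zero.2 h0))
  filter_upwards [hbound, hdet] with N hN hNdet z hz
  by_contra hzS
  refine hNdet z ⟨mem_closedBall_zero_iff.2 ?_, hzS⟩ (mem_spectrum_iff_det_eq_zero.1 hz)
  exact (norm_le_card_mul_norm_of_mem_spectrum hz).trans (by gcongr)

theorem isClosed_setOf_spectrum_subset (hS : IsClosed S) :
    IsClosed {M : Matrix n n ℂ | spectrum ℂ M ⊆ S} := by
  refine isOpen_compl_iff.1 (isOpen_iff_mem_nhds.2 fun M hM => ?_)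
  obtain ⟨a, ha, haS⟩ := not_subset.1 hM
  obtain ⟨ε, hε, hball⟩ := Metric.isOpen_iff.1 hS.isOpen_compl a haS
  have hcont : Continuous fun N : Matrix n n ℂ => ‖(scalar n a - N).det‖ := by fun_prop
  have hdet : ‖(scalar n a - M).det‖ < ε ^ Fintype.card n := by
    rw [mem_spectrum_iff_det_eq_zero.1 ha, norm_zero]
    positivity
  filter_upwards [hcont.continuousAt.eventually_lt_const hdet] with N hN hNS
  obtain ⟨b, hb, hab⟩ := exists_mem_spectrum_norm_sub_lt hε.le hN
  exact hball (mem_ball_iff_norm'.2 hab) (hNS hb)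

theorem interior_setOf_spectrum_subset :
    interior {M : Matrix n n ℂ | spectrum ℂ M ⊆ S} = {M | spectrum ℂ M ⊆ interior S} := by
  refine subset_antisymm (fun M hM a ha => mem_interior_iff_mem_nhds.2 ?_)
    (interior_maximal (fun M hM => hM.trans interior_subset)
      (isOpen_setOf_spectrum_subset isOpen_interior))
  have hcont : Continuous fun z : ℂ => algebraMap ℂ (Matrix n n ℂ) (z - a) + M := by
    simp only [Algebra.algebraMap_eq_smul_one]
    fun_prop
  have hnear := hcont.continuousAt.preimage_mem_nhds (x := a) (t := {N | spectrum ℂ N ⊆ S})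
    (by simpa using mem_interior_iff_mem_nhds.1 hM)
  filter_upwards [hnear] with z hz
  refine hz ?_
  rw [← spectrum.vadd_eq]
  exact ⟨a, ha, by simp⟩

theorem frontier_setOf_spectrum_subset (hS : IsClosed S) :
    frontier {M : Matrix n n ℂ | spectrum ℂ M ⊆ S} =
      {M | spectrum ℂ M ⊆ S ∧ (spectrum ℂ M ∩ frontier S).Nonempty} := by
  rw [(isClosed_setOf_spectrum_subset hS).frontier_eq, interior_setOf_spectrum_subset,
    hS.frontier_eq]
  ext M
  simp only [Set.mem_sdiff, mem_ofPred_eq, not_subset, Set.Nonempty, mem_inter_iff]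
  exact ⟨fun ⟨hM, a, ha, haS⟩ => ⟨hM, a, ha, hM ha, haS⟩,
    fun ⟨hM, a, ha, _, haS⟩ => ⟨hM, a, ha, haS⟩⟩

end SpectrumTopology

section SimpleSpectrum

variable {n : Type*} [Fintype n] [DecidableEq n]

section RankOnePerturbation

variable {R : Type*} [CommRing R]

theorem X_mul_charpoly_vecMulVec (v w : n → R) :
    X * (vecMulVec v w).charpoly = (X - C (v ⬝ᵥ w)) * X ^ Fintype.card n := by
  rw [charpoly_vecMulVec, smul_eq_C_mul]
  rcases isEmpty_or_nonempty n
  · simp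
  · obtain ⟨k, hk⟩ := Nat.exists_eq_succ_of_ne_zero (Fintype.card_ne_zero (α := n))
    rw [hk, Nat.succ_sub_one, pow_succ]
    ring

theorem smul_scalar_sub_add_vecMulVec {M : Matrix n n R} {a : R} {v : n → R}
    (hv : M *ᵥ v = a • v) (w : n → R) (z : R) :
    (z - a) • (scalar n z - (M + vecMulVec v w)) =
      (scalar n z - M) * (scalar n (z - a) - vecMulVec v w) := by
  have hMv : M * vecMulVec v w = a • vecMulVec v w := by
    rw [mul_vecMulVec, hv, smul_vecMulVec]
  simp only [scalar_apply, ← smul_one_eq_diagonal, mul_sub, sub_mul, hMv, smul_mul_assoc,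
    mul_smul_comm, one_mul, mul_one]
  module

theorem X_sub_C_mul_charpoly_add_vecMulVec [IsDomain R] [Infinite R] {M : Matrix n n R} {a : R}
    {v : n → R} (hv : M *ᵥ v = a • v) (w : n → R) :
    (X - C a) * (M + vecMulVec v w).charpoly = (X - C (a + v ⬝ᵥ w)) * M.charpoly := by
  refine eq_of_infinite_eval_eq _ _ ((Set.finite_singleton a).infinite_compl.mono fun z hz => ?_)
  have hza : z - a ≠ 0 := sub_ne_zero.2 hz
  have hdet := congrArg det (smul_scalar_sub_add_vecMulVec hv w z)
  have hrank := congrArg (eval (z - a)) (X_mul_charpoly_vecMulVec v w)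
  rw [det_smul, det_mul] at hdet
  simp only [eval_mul, eval_X, eval_sub, eval_C, eval_pow, eval_charpoly] at hrank
  simp only [mem_ofPred_eq, eval_mul, eval_X, eval_sub, eval_C, eval_charpoly]
  refine mul_left_cancel₀ (pow_ne_zero (Fintype.card n) hza) ?_
  linear_combination (z - a) * hdet + (scalar n z - M).det * hrank

theorem exists_forall_roots_charpoly_add_smul {K : Type*} [Field K] [Infinite K]
    [DecidableEq K] {M : Matrix n n K} {a : K} (ha : a ∈ M.charpoly.roots) :
    ∃ A : Matrix n n K, ∀ b, (M + (b - a) • A).charpoly.roots = b ::ₘ M.charpoly.roots.erase a := by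
  have hdet : (scalar n a - M).det = 0 := by
    rw [← eval_charpoly]
    exact isRoot_of_mem_roots ha
  obtain ⟨v, hv0, hv⟩ := exists_mulVec_eq_zero_iff.2 hdet
  have hMv : M *ᵥ v = a • v := by
    simpa [sub_mulVec, sub_eq_zero, eq_comm] using hv
  obtain ⟨i, hi⟩ := Function.ne_iff.1 hv0
  refine ⟨vecMulVec v (Pi.single i (v i)⁻¹), fun b => ?_⟩
  have hchar := X_sub_C_mul_charpoly_add_vecMulVec hMv ((b - a) • Pi.single i (v i)⁻¹)
  rw [vecMulVec_smul, dotProduct_smul, dotProduct_single, mul_inv_cancel₀ hi, smul_eq_mul, mul_one,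
    add_sub_cancel] at hchar
  have hroots := congrArg roots hchar
  rw [roots_mul ((monic_X_sub_C a).mul (charpoly_monic _)).ne_zero,
    roots_mul ((monic_X_sub_C b).mul (charpoly_monic _)).ne_zero, roots_X_sub_C, roots_X_sub_C,
    Multiset.singleton_add, Multiset.singleton_add, ← Multiset.cons_erase ha,
    Multiset.cons_swap] at hroots
  exact (Multiset.cons_inj_right a).1 hroots

end RankOnePerturbation

theorem mem_closure_setOf_card_toFinset_roots_charpoly_lt {S : Set ℂ} (hS : Preperfect S)
    {M : Matrix n n ℂ} (hM : spectrum ℂ M ⊆ S) (hnodup : ¬ M.charpoly.roots.Nodup) :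
    M ∈ closure {N | spectrum ℂ N ⊆ S ∧
      M.charpoly.roots.toFinset.card < N.charpoly.roots.toFinset.card} := by
  obtain ⟨a, ha⟩ : ∃ a, 1 < M.charpoly.roots.count a := by
    simpa [Multiset.nodup_iff_count_le_one] using hnodup
  have haroot : a ∈ M.charpoly.roots := Multiset.count_pos.1 (by lia)
  have hfinset : (M.charpoly.roots.erase a).toFinset = M.charpoly.roots.toFinset := by
    ext z
    rw [Multiset.mem_toFinset, Multiset.mem_toFinset]
    rcases eq_or_ne z a with rfl | hza
    · rw [← Multiset.count_pos, Multiset.count_erase_self]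
      exact iff_of_true (by lia) haroot
    · exact Multiset.mem_erase_of_ne hza
  obtain ⟨A, hA⟩ := exists_forall_roots_charpoly_add_smul haroot
  have hnotroot : ∀ᶠ b in 𝓝[≠] a, b ∉ M.charpoly.roots := by
    refine nhdsNE_le_cofinite a (M.charpoly.roots.toFinset.finite_toSet.subset fun b hb => ?_)
    simpa using hb
  have hfreq : ∃ᶠ b in 𝓝[≠] a, M + (b - a) • A ∈ {N | spectrum ℂ N ⊆ S ∧
      M.charpoly.roots.toFinset.card < N.charpoly.roots.toFinset.card} := by
    have hacc := accPt_iff_frequently_nhdsNE.1 (hS a (hM (mem_roots_charpoly_iff.1 haroot)))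
    refine (hacc.and_eventually hnotroot).mono fun b ⟨hbS, hb⟩ => ⟨fun z hz => ?_, ?_⟩
    · rw [← mem_roots_charpoly_iff, hA, Multiset.mem_cons] at hz
      rcases hz with rfl | hz
      · exact hbS
      · exact hM (mem_roots_charpoly_iff.1 (Multiset.mem_of_mem_erase hz))
    · rw [hA, Multiset.toFinset_cons, hfinset,
        Finset.card_insert_of_notMem (mt Multiset.mem_toFinset.1 hb)]
      exact Nat.lt_succ_self _
  refine mem_closure_of_frequently_of_tendsto hfreq (Tendsto.mono_left ?_ nhdsWithin_le_nhds)
  have hcont : Continuous fun b : ℂ => M + (b - a) • A := by fun_prop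
  simpa using hcont.tendsto a

theorem mem_closure_setOf_spectrum_subset_and_nodup {S : Set ℂ} (hS : Preperfect S)
    {M : Matrix n n ℂ} (hM : spectrum ℂ M ⊆ S) :
    M ∈ closure {N | spectrum ℂ N ⊆ S ∧ N.charpoly.roots.Nodup} := by
  induction hk : Fintype.card n - M.charpoly.roots.toFinset.card using Nat.strong_induction_on
    generalizing M with
  | _ k ih =>
  by_cases hnodup : M.charpoly.roots.Nodup
  · exact subset_closure ⟨hM, hnodup⟩
  · refine closure_minimal (fun N hN => ?_) isClosed_closure
      (mem_closure_setOf_card_toFinset_roots_charpoly_lt hS hM hnodup)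
    have hcard := (Multiset.toFinset_card_le N.charpoly.roots).trans_eq card_roots_charpoly
    exact ih _ (by have := hN.2; lia) hN.1 rfl

end SimpleSpectrum

section FunctionalCalculus

variable {n : Type*} [Fintype n] [DecidableEq n] {M : Matrix n n ℂ}

theorem iterate_aeval_apply {R A : Type*} [CommSemiring R] [Semiring A] [Algebra R A] (p : R[X])
    (k : ℕ) (x : A) : (fun y => aeval y p)^[k] x = aeval x (p.comp^[k] X) := by
  induction k with
  | zero => simp
  | succ k ih => rw [Function.iterate_succ_apply', ih, Function.iterate_succ_apply', aeval_comp]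

theorem aeval_eq_sum_eval_smul_of_nodup_roots (h : M.charpoly.roots.Nodup) (f : ℂ[X]) :
    aeval M f = ∑ a ∈ M.charpoly.roots.toFinset,
      f.eval a • aeval M (Lagrange.basis M.charpoly.roots.toFinset id a) := by
  set s := M.charpoly.roots.toFinset
  have hnodal : Lagrange.nodal s id = M.charpoly := by
    conv_rhs => rw [(IsAlgClosed.splits _).eq_prod_roots_of_monic M.charpoly_monic]
    rw [Lagrange.nodal_eq, Finset.prod_eq_multiset_prod, Multiset.toFinset_val, h.dedup]
    rfl
  have hmod : f %ₘ M.charpoly = Lagrange.interpolate s id fun a => f.eval a := by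
    refine Lagrange.eq_interpolate_of_eval_eq _ (injOn_id _) ?_ fun a ha => ?_
    · rw [← Lagrange.degree_nodal (v := id), hnodal]
      exact degree_modByMonic_lt f M.charpoly_monic
    · have hroot : aeval a M.charpoly = 0 := by
        rw [coe_aeval_eq_eval]
        exact isRoot_of_mem_roots (Multiset.mem_toFinset.1 ha)
      simpa only [coe_aeval_eq_eval, id_eq] using aeval_modByMonic_eq_self_of_root (p := f) hroot
  rw [← aeval_modByMonic_eq_self_of_root (aeval_self_charpoly M), hmod,
    Lagrange.interpolate_apply, map_sum]
  simp only [map_mul, aeval_C, Algebra.smul_def]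

theorem mem_boundedOrbitSet_aeval_of_nodup_roots {p : ℂ[X]}
    (hM : spectrum ℂ M ⊆ filledJulia p) (h : M.charpoly.roots.Nodup) :
    M ∈ boundedOrbitSet fun N : Matrix n n ℂ => aeval N p := by
  choose! C hC using fun a (ha : a ∈ M.charpoly.roots.toFinset) => mem_boundedOrbitSet_iff.1 <|
    hM (mem_roots_charpoly_iff.1 (Multiset.mem_toFinset.1 ha))
  refine mem_boundedOrbitSet_iff.2 ⟨∑ a ∈ M.charpoly.roots.toFinset,
    C a * ‖aeval M (Lagrange.basis M.charpoly.roots.toFinset id a)‖, fun k => ?_⟩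
  rw [iterate_aeval_apply, aeval_eq_sum_eval_smul_of_nodup_roots h]
  refine norm_sum_le_of_le _ fun a ha => ?_
  rw [norm_smul, iterate_comp_eval, eval_X]
  gcongr
  exact hC a ha k

theorem norm_eval_divByMonic_X_sub_C_le {S : Set ℂ} {f : ℂ[X]} {a : ℂ} {R δ : ℝ} (hδ : 0 < δ)
    (ha : closedBall a δ ⊆ S) (hf : ∀ z ∈ S, ‖f.eval z‖ ≤ R) :
    ∀ z ∈ S, ‖(f /ₘ (X - C a)).eval z‖ ≤ R * (2 / δ) := by
  have haS : a ∈ S := ha (mem_closedBall_self hδ.le)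
  have hR : 0 ≤ R := (norm_nonneg _).trans (hf a haS)
  have hfar : ∀ z ∈ S, δ ≤ ‖z - a‖ → ‖(f /ₘ (X - C a)).eval z‖ ≤ R * (2 / δ) := by
    intro z hz hza
    have hmul : (z - a) * (f /ₘ (X - C a)).eval z = f.eval z - f.eval a := by
      have h := congrArg (eval z) (X_sub_C_mul_divByMonic_eq_sub_modByMonic f a)
      simpa [modByMonic_X_sub_C_eq_C_eval] using h
    have hnorm : ‖z - a‖ * ‖(f /ₘ (X - C a)).eval z‖ ≤ R + R := by
      rw [← norm_mul, hmul]
      exact norm_sub_le_of_le (hf z hz) (hf a haS)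
    rw [← mul_div_assoc, le_div_iff₀ hδ]
    nlinarith [norm_nonneg ((f /ₘ (X - C a)).eval z)]
  intro z hz
  rcases le_or_gt δ ‖z - a‖ with hza | hza
  · exact hfar z hz hza
  · refine Complex.norm_le_of_forall_mem_frontier_norm_le isBounded_ball
      (f /ₘ (X - C a)).differentiable.diffContOnCl (fun w hw => ?_)
      (subset_closure (mem_ball_iff_norm.2 hza))
    rw [frontier_ball a hδ.ne'] at hw
    exact hfar w (ha (sphere_subset_closedBall hw)) (mem_sphere_iff_norm.1 hw).ge

theorem norm_mul_aeval_le {S : Set ℂ} {δ c : ℝ} (hδ : 0 < δ) {s : Multiset ℂ}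
    (hs : ∀ a ∈ s, closedBall a δ ⊆ S ∧ ‖M - algebraMap ℂ _ a‖ ≤ c) {B : Matrix n n ℂ}
    (hB : B * aeval M (s.map fun a => X - C a).prod = 0) {f : ℂ[X]} {R : ℝ}
    (hf : ∀ z ∈ S, ‖f.eval z‖ ≤ R) :
    ‖B * aeval M f‖ ≤
      R * ‖B‖ * ∑ k ∈ Finset.range s.card, (Fintype.card n * c * (2 / δ)) ^ k := by
  induction s using Multiset.induction_on generalizing B f R with
  | empty => simp_all
  | cons a s ih =>
    obtain ⟨⟨ha, hc⟩, hs⟩ := Multiset.forall_mem_cons.1 hs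
    have hfa : ‖f.eval a‖ ≤ R := hf a (ha (mem_closedBall_self hδ.le))
    have hR : 0 ≤ R := (norm_nonneg _).trans hfa
    set q := f /ₘ (X - C a)
    set T := ∑ k ∈ Finset.range s.card, (Fintype.card n * c * (2 / δ)) ^ k
    have hsplit : B * aeval M f = f.eval a • B + B * (M - algebraMap ℂ _ a) * aeval M q := by
      have h := X_sub_C_mul_divByMonic_eq_sub_modByMonic f a
      rw [modByMonic_X_sub_C_eq_C_eval, eq_sub_iff_add_eq'] at h
      conv_lhs => rw [← h]
      rw [map_add, aeval_C, map_mul, map_sub, aeval_X, aeval_C, mul_add, ← mul_assoc,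
        ← Algebra.commutes, Algebra.smul_def]
    have hrest : ‖B * (M - algebraMap ℂ _ a) * aeval M q‖ ≤
        R * (2 / δ) * ‖B * (M - algebraMap ℂ _ a)‖ * T := by
      refine ih hs ?_ (norm_eval_divByMonic_X_sub_C_le hδ ha hf)
      simpa [mul_assoc] using hB
    have hT : 0 ≤ T := by
      have := (norm_nonneg _).trans hc
      positivity
    calc ‖B * aeval M f‖ ≤ R * ‖B‖ + R * (2 / δ) * (Fintype.card n * ‖B‖ * c) * T := by
          rw [hsplit]
          refine norm_add_le_of_le ?_ (hrest.trans ?_)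
          · rw [norm_smul]
            gcongr
          · gcongr
            exact (norm_matrix_mul_le _ _).trans (by gcongr)
      _ = R * ‖B‖ * ∑ k ∈ Finset.range (a ::ₘ s).card, (Fintype.card n * c * (2 / δ)) ^ k := by
          rw [Multiset.card_cons, geom_sum_succ]
          ring

theorem norm_aeval_le {S : Set ℂ} {δ R : ℝ} (hδ : 0 < δ)
    (hM : ∀ a ∈ spectrum ℂ M, closedBall a δ ⊆ S) {f : ℂ[X]} (hR : 0 ≤ R)
    (hf : ∀ z ∈ S, ‖f.eval z‖ ≤ R) :
    ‖aeval M f‖ ≤ R * ∑ k ∈ Finset.range (Fintype.card n),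
      (Fintype.card n * ((1 + Fintype.card n) * ‖M‖) * (2 / δ)) ^ k := by
  have hsub : ∀ a ∈ spectrum ℂ M, ‖M - algebraMap ℂ _ a‖ ≤ (1 + Fintype.card n) * ‖M‖ := by
    intro a ha
    rw [Algebra.algebraMap_eq_smul_one, one_add_mul]
    refine norm_sub_le_of_le le_rfl ?_
    rw [norm_smul]
    exact (mul_le_of_le_one_right (norm_nonneg a) norm_one_matrix_le_one).trans
      (norm_le_card_mul_norm_of_mem_spectrum ha)
  have hzero : 1 * aeval M (M.charpoly.roots.map fun a => X - C a).prod = 0 := by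
    rw [← (IsAlgClosed.splits _).eq_prod_roots_of_monic M.charpoly_monic, one_mul,
      aeval_self_charpoly]
  have h := norm_mul_aeval_le hδ (s := M.charpoly.roots)
    (fun a ha => have ha := mem_roots_charpoly_iff.1 ha; ⟨hM a ha, hsub a ha⟩) hzero hf
  rw [one_mul, card_roots_charpoly] at h
  refine h.trans ?_
  gcongr
  exact mul_le_of_le_one_right hR norm_one_matrix_le_one

theorem exists_eventually_forall_norm_aeval_le {U : Set ℂ} (hU : IsOpen U)
    (hM : spectrum ℂ M ⊆ U) : ∃ C, ∀ᶠ N in 𝓝 M, ∀ (f : ℂ[X]) (R : ℝ), 0 ≤ R →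
      (∀ z ∈ U, ‖f.eval z‖ ≤ R) → ‖aeval N f‖ ≤ R * C := by
  obtain ⟨δ, hδ, hδU⟩ :=
    (Matrix.finite_spectrum M).isCompact.exists_cthickening_subset_open hU hM
  have hspec : ∀ᶠ N in 𝓝 M, spectrum ℂ N ⊆ thickening (δ / 2) (spectrum ℂ M) :=
    (isOpen_setOf_spectrum_subset isOpen_thickening).mem_nhds
      (self_subset_thickening (half_pos hδ) _)
  have hnorm : ∀ᶠ N in 𝓝 M, ‖N‖ < ‖M‖ + 1 :=
    continuous_norm.continuousAt.eventually_lt_const (lt_add_one _)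
  refine ⟨∑ k ∈ Finset.range (Fintype.card n),
    (Fintype.card n * ((1 + Fintype.card n) * (‖M‖ + 1)) * (2 / (δ / 2))) ^ k, ?_⟩
  filter_upwards [hspec, hnorm] with N hN hNnorm f R hR hf
  have hball : ∀ a ∈ spectrum ℂ N, closedBall a (δ / 2) ⊆ U := fun a ha z hz => by
    obtain ⟨b, hb, hab⟩ := mem_thickening_iff.1 (hN ha)
    refine hδU (mem_cthickening_of_dist_le z b δ _ hb ?_)
    linarith [dist_triangle z a b, mem_closedBall.1 hz]
  refine (norm_aeval_le (half_pos hδ) hball hR hf).trans ?_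
  gcongr

end FunctionalCalculus

section MatrixDynamics

variable {n : Type*} [Fintype n] [DecidableEq n] {p : ℂ[X]} {M : Matrix n n ℂ}

theorem iterate_eval_mem_spectrum {a : ℂ} (ha : a ∈ spectrum ℂ M) (k : ℕ) :
    (fun z => p.eval z)^[k] a ∈ spectrum ℂ ((fun N : Matrix n n ℂ => aeval N p)^[k] M) := by
  have h := spectrum.subset_polynomial_aeval M (p.comp^[k] X) (mem_image_of_mem _ ha)
  rwa [iterate_comp_eval, eval_X, ← iterate_aeval_apply] at h

theorem differentiable_aeval_matrix (p : ℂ[X]) :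
    Differentiable ℂ fun M : Matrix n n ℂ => aeval M p := by
  have hpow (k : ℕ) : Differentiable ℂ fun M : Matrix n n ℂ => M ^ k := by
    induction k with
    | zero => simp only [pow_zero, differentiable_const]
    | succ k ih =>
      simp only [pow_succ]
      exact differentiable_matrix_mul ih differentiable_id
  simp only [aeval_eq_sum_range]
  exact Differentiable.fun_sum fun k _ => (hpow k).fun_const_smul _

theorem spectrum_subset_filledJulia_of_mem_boundedOrbitSet
    (h : M ∈ boundedOrbitSet fun N : Matrix n n ℂ => aeval N p) : spectrum ℂ M ⊆ filledJulia p := by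
  intro a ha
  obtain ⟨C, hC⟩ := mem_boundedOrbitSet_iff.1 h
  refine mem_boundedOrbitSet_iff.2 ⟨Fintype.card n * C, fun k => ?_⟩
  refine (norm_le_card_mul_norm_of_mem_spectrum (iterate_eval_mem_spectrum ha k)).trans ?_
  gcongr
  exact hC k

theorem closure_boundedOrbitSet_aeval (hp : 2 ≤ p.natDegree) :
    closure (boundedOrbitSet fun M : Matrix n n ℂ => aeval M p) =
      {M | spectrum ℂ M ⊆ filledJulia p} := by
  refine subset_antisymm
    (closure_minimal (fun M => spectrum_subset_filledJulia_of_mem_boundedOrbitSet)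
      (isClosed_setOf_spectrum_subset (isClosed_filledJulia hp))) fun M hM => ?_
  exact closure_mono (fun N hN => mem_boundedOrbitSet_aeval_of_nodup_roots hN.1 hN.2)
    (mem_closure_setOf_spectrum_subset_and_nodup (preperfect_filledJulia hp) hM)

theorem divergesLocallyUniformlyOn_iterate_aeval (hp : 2 ≤ p.natDegree) :
    DivergesLocallyUniformlyOn (fun k => (fun M : Matrix n n ℂ => aeval M p)^[k])
      {M | spectrum ℂ M ⊆ filledJulia p}ᶜ := by
  refine divergesLocallyUniformlyOn_of_forall_exists_mem_nhdsWithin fun M hM C => ?_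
  obtain ⟨a, ha, haK⟩ := not_subset.1 hM
  obtain ⟨ε, hε, hball⟩ :=
    nhds_basis_closedBall.mem_iff.1 ((isClosed_filledJulia hp).isOpen_compl.mem_nhds haK)
  obtain ⟨R, hR⟩ := exists_isEscapeRadius hp
  have hnear : {N : Matrix n n ℂ | spectrum ℂ N ⊆ (ball a ε)ᶜ}ᶜ ∈ 𝓝 M :=
    (isClosed_setOf_spectrum_subset isOpen_ball.isClosed_compl).isOpen_compl.mem_nhds
      fun h => h ha (mem_ball_self hε)
  refine ⟨_, mem_nhdsWithin_of_mem_nhds hnear, ?_⟩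
  filter_upwards [hR.divergesLocallyUniformlyOn_compl p.continuous _ hball
    (isCompact_closedBall a ε) (Fintype.card n * C)] with k hk N hN
  obtain ⟨b, hb, hba⟩ := not_subset.1 hN
  have h := (hk b (ball_subset_closedBall (not_not.1 hba))).trans_le
    (norm_le_card_mul_norm_of_mem_spectrum (iterate_eval_mem_spectrum hb k))
  exact lt_of_mul_lt_mul_left h (Nat.cast_nonneg _)

theorem exists_eventually_norm_iterate_aeval_le (hp : 2 ≤ p.natDegree)
    (hM : spectrum ℂ M ⊆ interior (filledJulia p)) :
    ∃ C, ∀ᶠ N in 𝓝 M, ∀ k, ‖(fun N : Matrix n n ℂ => aeval N p)^[k] N‖ ≤ C := by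
  obtain ⟨R, hR⟩ := exists_isEscapeRadius hp
  obtain ⟨C, hC⟩ := exists_eventually_forall_norm_aeval_le isOpen_interior hM
  refine ⟨R * C, hC.mono fun N hN k => ?_⟩
  rw [iterate_aeval_apply]
  refine hN _ R hR.1.le fun z hz => ?_
  rw [iterate_comp_eval, eval_X]
  exact hR.norm_iterate_le (interior_subset hz) k

end MatrixDynamics

theorem theorem1p1_general {n : Type*} [Fintype n] [DecidableEq n] (p : ℂ[X])
    (hp : 2 ≤ p.natDegree) :
    juliaSet (fun M : Matrix n n ℂ => aeval M p) =
        frontier (closure (boundedOrbitSet fun M : Matrix n n ℂ => aeval M p)) ∧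
      juliaSet (fun M : Matrix n n ℂ => aeval M p) =
        {M | spectrum ℂ M ⊆ filledJulia p ∧ (spectrum ℂ M ∩ polyJulia p).Nonempty} := by
  have : ProperSpace (Matrix n n ℂ) := FiniteDimensional.proper ℂ _
  have hclosure := closure_boundedOrbitSet_aeval (n := n) hp
  have hinterior : interior (closure (boundedOrbitSet fun M : Matrix n n ℂ => aeval M p)) =
      {M | spectrum ℂ M ⊆ interior (filledJulia p)} := by
    rw [hclosure, interior_setOf_spectrum_subset]
  have hjulia : juliaSet (fun M : Matrix n n ℂ => aeval M p) =
      frontier (closure (boundedOrbitSet fun M : Matrix n n ℂ => aeval M p)) :=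
    juliaSet_eq_frontier_closure_boundedOrbitSet (differentiable_aeval_matrix p)
      (hclosure ▸ divergesLocallyUniformlyOn_iterate_aeval hp)
      fun M hM => exists_eventually_norm_iterate_aeval_le hp (hinterior.subset hM)
  refine ⟨hjulia, ?_⟩
  rw [hjulia, hclosure, frontier_setOf_spectrum_subset (isClosed_filledJulia hp), polyJulia]

section NormalForm

variable {K : Type*} [Field K]

theorem exists_eq_conj_of_mul_eq_mul {n : Type*} [Fintype n] [DecidableEq n]
    {M T Q : Matrix n n K} (hQ : Q.det ≠ 0) (h : M * Q = Q * T) :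
    ∃ U : GL n K, M = U * T * (U⁻¹ : GL n K) :=
  ⟨GeneralLinearGroup.mkOfDetNeZero Q hQ, (Units.eq_mul_inv_iff_mul_eq _).2 h⟩

theorem exists_eq_conj_upperTriangular [IsAlgClosed K] (M : Matrix (Fin 2) (Fin 2) K) :
    ∃ (Q : GL (Fin 2) K) (a t b : K), M = Q * !![a, t; 0, b] * (Q⁻¹ : GL (Fin 2) K) := by
  obtain ⟨a, ha⟩ := spectrum.nonempty_of_isAlgClosed_of_finiteDimensional K M
  rw [← spectrum_toLin', ← Module.End.hasEigenvalue_iff_mem_spectrum] at ha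
  obtain ⟨v, hv⟩ := ha.exists_hasEigenvector
  have hMv : M *ᵥ v = a • v := hv.apply_eq_smul
  obtain ⟨w, hw⟩ : ∃ w : Fin 2 → K, !![v 0, w 0; v 1, w 1].det ≠ 0 := by
    by_contra! h
    refine hv.2 (funext fun i => ?_)
    fin_cases i
    · simpa [det_fin_two] using h ![0, 1]
    · simpa [det_fin_two] using h ![1, 0]
  set Q := !![v 0, w 0; v 1, w 1]
  have hunit : IsUnit Q.det := isUnit_iff_ne_zero.2 hw
  have hQv : Q *ᵥ Pi.single 0 1 = v := by
    ext i
    fin_cases i <;> simp [Q]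
  have hcol : (Q⁻¹ * M * Q).col 0 = a • Pi.single 0 1 := by
    rw [← mulVec_single_one, ← mulVec_mulVec, hQv, ← mulVec_mulVec, hMv, mulVec_smul, ← hQv,
      mulVec_mulVec, nonsing_inv_mul Q hunit, one_mulVec]
  have hT : Q⁻¹ * M * Q = !![a, (Q⁻¹ * M * Q) 0 1; 0, (Q⁻¹ * M * Q) 1 1] := by
    rw [eta_fin_two (Q⁻¹ * M * Q)]
    have h0 : (Q⁻¹ * M * Q) 0 0 = a := by simpa using congrFun hcol 0
    have h1 : (Q⁻¹ * M * Q) 1 0 = 0 := by simpa using congrFun hcol 1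
    simp [h0, h1]
  obtain ⟨U, hU⟩ := exists_eq_conj_of_mul_eq_mul hw (T := Q⁻¹ * M * Q) (M := M) (by
    rw [mul_assoc, mul_nonsing_inv_cancel_left _ _ hunit])
  exact ⟨U, a, _, _, hU.trans (by rw [← hT])⟩

theorem exists_upperTriangular_eq_conj (a t b : K) :
    ∃ (Q : GL (Fin 2) K) (s : K), (s = 0 ∨ s = 1 ∧ a = b) ∧
      !![a, t; 0, b] = Q * !![a, s; 0, b] * (Q⁻¹ : GL (Fin 2) K) := by
  rcases eq_or_ne a b with rfl | hab
  · rcases eq_or_ne t 0 with rfl | ht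
    · exact ⟨1, 0, Or.inl rfl, by simp⟩
    · obtain ⟨Q, hQ⟩ := exists_eq_conj_of_mul_eq_mul (M := !![a, t; 0, a]) (T := !![a, 1; 0, a])
        (Q := !![t, 0; 0, 1]) (by simpa [det_fin_two] using ht) (by simp [mul_comm])
      exact ⟨Q, 1, Or.inr ⟨rfl, rfl⟩, hQ⟩
  · have hba : b - a ≠ 0 := sub_ne_zero.2 hab.symm
    have hshear : a * (t / (b - a)) + t = t / (b - a) * b := by
      field_simp
      ring
    obtain ⟨Q, hQ⟩ := exists_eq_conj_of_mul_eq_mul (M := !![a, t; 0, b]) (T := !![a, 0; 0, b])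
      (Q := !![1, t / (b - a); 0, 1]) (by simp [det_fin_two]) (by simp [hshear])
    exact ⟨Q, 0, Or.inl rfl, hQ⟩

theorem exists_eq_conj_normalForm [IsAlgClosed K] (M : Matrix (Fin 2) (Fin 2) K) :
    ∃ (Q : GL (Fin 2) K) (a s b : K), (s = 0 ∨ s = 1 ∧ a = b) ∧
      M = Q * !![a, s; 0, b] * (Q⁻¹ : GL (Fin 2) K) := by
  obtain ⟨U, a, t, b, hU⟩ := exists_eq_conj_upperTriangular M
  obtain ⟨V, s, hs, hV⟩ := exists_upperTriangular_eq_conj a t b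
  refine ⟨U * V, a, s, b, hs, ?_⟩
  rw [hU, hV, _root_.mul_inv_rev, Units.val_mul, Units.val_mul]
  simp only [mul_assoc]

theorem spectrum_conj_upperTriangular (Q : GL (Fin 2) K) (a t b : K) :
    spectrum K ((Q : Matrix (Fin 2) (Fin 2) K) * !![a, t; 0, b] * (Q⁻¹ : GL (Fin 2) K)) =
      {a, b} := by
  rw [spectrum.units_conjugate]
  ext z
  rw [mem_spectrum_iff_det_eq_zero, det_fin_two]
  simp [sub_eq_zero]

end NormalForm

theorem setOf_spectrum_subset_and_inter_nonempty_eq {S J : Set ℂ} (hJ : J ⊆ S) :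
    {M : Matrix (Fin 2) (Fin 2) ℂ | spectrum ℂ M ⊆ S ∧ (spectrum ℂ M ∩ J).Nonempty} =
      {M | ∃ (Q : GL (Fin 2) ℂ) (a b : ℂ), (a, b) ∈ (S ×ˢ J) ∪ (J ×ˢ S) ∧
          M = (Q : Matrix (Fin 2) (Fin 2) ℂ) * !![a, 0; 0, b] *
            ((Q⁻¹ : GL (Fin 2) ℂ) : Matrix (Fin 2) (Fin 2) ℂ)} ∪
      {M | ∃ (Q : GL (Fin 2) ℂ) (a : ℂ), a ∈ J ∧
          M = (Q : Matrix (Fin 2) (Fin 2) ℂ) * !![a, 1; 0, a] *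
            ((Q⁻¹ : GL (Fin 2) ℂ) : Matrix (Fin 2) (Fin 2) ℂ)} := by
  have hspec (Q : GL (Fin 2) ℂ) (a t b : ℂ) (M : Matrix (Fin 2) (Fin 2) ℂ)
      (hM : M = Q * !![a, t; 0, b] * (Q⁻¹ : GL (Fin 2) ℂ)) :
      (spectrum ℂ M ⊆ S ∧ (spectrum ℂ M ∩ J).Nonempty) ↔ (a, b) ∈ (S ×ˢ J) ∪ (J ×ˢ S) := by
    rw [hM, spectrum_conj_upperTriangular, insert_subset_iff, singleton_subset_iff,
      inter_nonempty_iff_exists_left]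
    simp only [mem_insert_iff, mem_singleton_iff, exists_eq_or_imp, exists_eq_left, mem_union,
      mem_prod]
    tauto
  ext M
  constructor
  · intro hM
    obtain ⟨Q, a, s, b, rfl | ⟨rfl, rfl⟩, hQ⟩ := exists_eq_conj_normalForm M
    · exact Or.inl ⟨Q, a, b, (hspec Q a 0 b M hQ).1 hM, hQ⟩
    · exact Or.inr ⟨Q, a, ((hspec Q a 1 a M hQ).1 hM).elim And.right And.left, hQ⟩
  · rintro (⟨Q, a, b, hab, hQ⟩ | ⟨Q, a, ha, hQ⟩)
    · exact (hspec Q a 0 b M hQ).2 hab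
    · exact (hspec Q a 1 a M hQ).2 (Or.inl ⟨hJ ha, ha⟩)

theorem theorem1p1 (p : ℂ[X]) (hp : 2 ≤ p.natDegree) :
    juliaSet (matrixPoly p) = frontier (closure (boundedOrbitSet (matrixPoly p))) ∧
    juliaSet (matrixPoly p) =
      {M | ∃ (Q : GL (Fin 2) ℂ) (a b : ℂ),
          (a, b) ∈ (filledJulia p ×ˢ polyJulia p) ∪ (polyJulia p ×ˢ filledJulia p) ∧
          M = (Q : Matrix (Fin 2) (Fin 2) ℂ) * !![a, 0; 0, b] *
            ((Q⁻¹ : GL (Fin 2) ℂ) : Matrix (Fin 2) (Fin 2) ℂ)} ∪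
      {M | ∃ (Q : GL (Fin 2) ℂ) (a : ℂ), a ∈ polyJulia p ∧
          M = (Q : Matrix (Fin 2) (Fin 2) ℂ) * !![a, 1; 0, a] *
            ((Q⁻¹ : GL (Fin 2) ℂ) : Matrix (Fin 2) (Fin 2) ℂ)} :=
  (theorem1p1_general p hp).imp_right fun h =>
    h.trans (setOf_spectrum_subset_and_inter_nonempty_eq (polyJulia_subset_filledJulia hp))
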